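/- \textbf{Theorem.} Let $\langle X,Y\rangle=\operatorname{tr}(XY^{\mathsf T})$ be the standard inner product on $\mathbb{R}^{3\times 3}$ with norm $\|\cdot\|$, and let $\mathrm{Sym}(3)\subset\mathbb{R}^{3\times 3}$ be the space of symmetric matrices. For $F\in\mathrm{GL}^+(3)$ let $$K_1=\|F\|,\qquad K_2=\|\operatorname{cof}F\|,\qquad K_3=\det F,\qquad \operatorname{cof}F=(\det F)F^{-\mathsf T}.$$ Let $U\subseteq\mathbb{R}^3$ be open (for example $U=(0,\infty)^3$), let $\Psi=\Psi(K_1,K_2,K_3)$ be twice continuously differentiable on $U$, and consider the isotropic strain energy $W(F)=\Psi(K_1,K_2,K_3)$. It depends on $F$ only through $\log V$, where $V=\sqrt{FF^{\mathsf T}}$; write $W(F)=\widehat W(\log V)$, and let the Cauchy stress be $$\widehat\sigma(\log V)=\frac{1}{\det V}\,\mathrm{D}_{\log V}\widehat W(\log V)\in\mathrm{Sym}(3),$$ the derivative being taken on $\mathrm{Sym}(3)$ and identified with a symmetric matrix through $\langle\cdot,\cdot\rangle$. Write $\Psi_i=\partial\Psi/\partial K_i$, $\Psi_{ij}=\partial^2\Psi/\partial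 K_i\partial K_j$ and $$M=\begin{bmatrix}K_1^2\Psi_{11}+K_1\Psi_1 & K_1K_2\Psi_{12} & K_1K_3\Psi_{13}-\tfrac12K_1\Psi_1\\ K_1K_2\Psi_{12} & K_2^2\Psi_{22}+K_2\Psi_2 & K_2K_3\Psi_{23}-\tfrac12K_2\Psi_2\\ K_1K_3\Psi_{13}-\tfrac12K_1\Psi_1 & K_2K_3\Psi_{23}-\tfrac12K_2\Psi_2 & K_3^2\Psi_{33}\end{bmatrix}.$$ Suppose that at the invariants $(K_1,K_2,K_3)$ of every $F\in\mathrm{GL}^+(3)$ for which they lie in $U$: (i) $\Psi_1>0$ and $\Psi_2\ge 0$, or $\Psi_1\ge 0$ and $\Psi_2>0$; (ii) $M$ is positive semidefinite; (iii) $\langle (1,2,3)^{\mathsf T},\,M\,(1,2,3)^{\mathsf T}\rangle>0$. Then the elastic response function $\widehat\sigma$ satisfies TSTS-M$^{++}$, that is, $$\bigl\langle \mathrm{D}_{\log V}\widehat\sigma(\log V).H,\,H\bigr\rangle>0\qquad\text{for all } H\in\mathrm{Sym}(3)\setminus\{0\}$$ at every $\log V\in\mathrm{Sym}(3)$ such that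 the invariants of $V=\exp(\log V)$ lie in $U$. In particular, this holds at every $\log V\in\mathrm{Sym}(3)$ if $U=(0,\infty)^3$. -/

import Mathlib

open Matrix
open scoped Gradient InnerProductSpace

noncomputable section

namespace Elast

/-- Second-order tensors on `ℝ³`. -/
abbrev Mat3 : Type := Matrix (Fin 3) (Fin 3) ℝ

/-- The Frobenius norm `‖X‖ = √⟨X, X⟩`, where `⟨X, Y⟩ = tr (X Yᵀ)` is the double contraction. -/
def frob (X : Mat3) : ℝ := √(X * Xᵀ).trace

/-- The symmetric second-order tensors as a subspace of `Mat3`. -/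
def symSubmodule : Submodule ℝ Mat3 where
  carrier := {X | Xᵀ = X}
  add_mem' {X Y} hX hY := by
    simp only [Set.mem_ofPred_eq] at *
    rw [Matrix.transpose_add, hX, hY]
  zero_mem' := by simp
  smul_mem' r X hX := by
    simp only [Set.mem_ofPred_eq] at *
    rw [Matrix.transpose_smul, hX]

/-- `Sym(3)`, the space of symmetric second-order tensors. It is a type of its own, so that its
only topology is the one of the norm below. -/
def Sym3 : Type := symSubmodule

namespace Sym3

instance : AddCommGroup Sym3 := inferInstanceAs (AddCommGroup symSubmodule)

instance : Module ℝ Sym3 := inferInstanceAs (Module ℝ symSubmodule)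

instance : FiniteDimensional ℝ Sym3 := inferInstanceAs (FiniteDimensional ℝ symSubmodule)

/-- The inclusion `Sym(3) → ℝ³ˣ³`. -/
def toMat : Sym3 →ₗ[ℝ] Mat3 := symSubmodule.subtype

theorem toMat_injective : Function.Injective toMat := Subtype.val_injective

theorem transpose_toMat (X : Sym3) : (toMat X)ᵀ = toMat X :=
  Subtype.property (p := fun Y : Mat3 => Yᵀ = Y) X

/-- The double contraction `⟨X, Y⟩ = tr (X Yᵀ)` is an inner product on `Sym(3)`. -/
@[reducible]
def core : InnerProductSpace.Core ℝ Sym3 where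
  inner X Y := (toMat X * (toMat Y)ᵀ).trace
  conj_inner_symm X Y := by
    simp only [conj_trivial]
    rw [← Matrix.trace_transpose]
    simp
  re_inner_nonneg X := by
    simp only [Matrix.trace, Matrix.diag, Matrix.mul_apply, Matrix.transpose_apply, ← sq,
      RCLike.re_to_real]
    positivity
  add_left X Y Z := by simp [add_mul]
  smul_left X Y r := by simp
  definite X h := by
    apply toMat_injective
    have h' : (toMat X * (toMat X)ᴴ).trace = 0 := by
      rw [Matrix.conjTranspose_eq_transpose_of_trivial]; exact h
    rw [map_zero]
    exact Matrix.trace_mul_conjTranspose_self_eq_zero_iff.1 h'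

instance : NormedAddCommGroup Sym3 := core.toNormedAddCommGroup

instance : InnerProductSpace ℝ Sym3 := InnerProductSpace.ofCore core.toCore

instance : CompleteSpace Sym3 := FiniteDimensional.complete ℝ Sym3

theorem inner_def (X Y : Sym3) : ⟪X, Y⟫_ℝ = (toMat X * (toMat Y)ᵀ).trace := rfl

end Sym3

/-- The cofactor `cof X = det X • X⁻ᵀ` (used for invertible `X` only). -/
def cof (X : Mat3) : Mat3 := X.det • (X⁻¹)ᵀ

/-- The root invariants `(K₁, K₂, K₃) = (‖F‖, ‖cof F‖, det F)` of a deformation gradient `F`. -/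
def rootInv (F : Mat3) : Fin 3 → ℝ := ![frob F, frob (cof F), F.det]

/-- The left stretch tensor `V = exp (log V)` with Hencky strain `log V = X`
(`exp` is the matrix exponential). -/
def stretch (X : Sym3) : Mat3 := NormedSpace.exp X.toMat

/-- The isotropic strain-energy `W(F) = Ψ(K₁, K₂, K₃)`. -/
def energy (Ψ : (Fin 3 → ℝ) → ℝ) (F : Mat3) : ℝ := Ψ (rootInv F)

/-- The strain-energy as a function of the Hencky strain: `Ŵ(log V) = W(V)`.
See `energy_eq_henckyEnergy` for `W(F) = Ŵ(log V)`, `V = √(F Fᵀ)`. -/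
def henckyEnergy (Ψ : (Fin 3 → ℝ) → ℝ) (X : Sym3) : ℝ := energy Ψ (stretch X)

/-- The Cauchy stress as a function of the Hencky strain:
`σ̂(log V) = J⁻¹ D_{log V} Ŵ(log V)`, `J = det V = det F`, the derivative being taken in `Sym(3)`
and identified with an element of `Sym(3)` through the double contraction. -/
def cauchyStress (Ψ : (Fin 3 → ℝ) → ℝ) (X : Sym3) : Sym3 :=
  ((stretch X).det)⁻¹ • ∇ (henckyEnergy Ψ) X

/-- TSTS-M⁺⁺ on a set `A` of admissible Hencky strains: the Fréchet derivative
`D_{log V} σ̂(log V)` is positive definite on `Sym(3)` for every `log V ∈ A`.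
(At a point where `σ` is not differentiable, `fderiv ℝ σ X = 0` and the condition fails.) -/
def TSTSMpp (σ : Sym3 → Sym3) (A : Set Sym3) : Prop :=
  ∀ X ∈ A, ∀ H : Sym3, H ≠ 0 → 0 < ⟪fderiv ℝ σ X H, H⟫_ℝ

/-- The Hencky strains whose root invariants lie in `U`. -/
def admissible (U : Set (Fin 3 → ℝ)) : Set Sym3 := {X | rootInv (stretch X) ∈ U}

/-- The partial derivative `∂Ψ/∂Kᵢ₊₁` (indices start at `0`). -/
def pd (Ψ : (Fin 3 → ℝ) → ℝ) (i : Fin 3) (K : Fin 3 → ℝ) : ℝ :=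
  fderiv ℝ Ψ K (Pi.single i 1)

/-- The second partial derivative `∂²Ψ/∂Kᵢ₊₁∂Kⱼ₊₁`. -/
def pd2 (Ψ : (Fin 3 → ℝ) → ℝ) (i j : Fin 3) (K : Fin 3 → ℝ) : ℝ := pd (pd Ψ j) i K

/-- The symmetric matrix of derivatives of `Ψ` in the sufficient conditions. -/
def condMatrix (Ψ : (Fin 3 → ℝ) → ℝ) (K : Fin 3 → ℝ) : Matrix (Fin 3) (Fin 3) ℝ :=
  !![K 0 ^ 2 * pd2 Ψ 0 0 K + K 0 * pd Ψ 0 K,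
      K 0 * K 1 * pd2 Ψ 0 1 K,
      K 0 * K 2 * pd2 Ψ 0 2 K - 1 / 2 * (K 0 * pd Ψ 0 K);
     K 0 * K 1 * pd2 Ψ 0 1 K,
      K 1 ^ 2 * pd2 Ψ 1 1 K + K 1 * pd Ψ 1 K,
      K 1 * K 2 * pd2 Ψ 1 2 K - 1 / 2 * (K 1 * pd Ψ 1 K);
     K 0 * K 2 * pd2 Ψ 0 2 K - 1 / 2 * (K 0 * pd Ψ 0 K),
      K 1 * K 2 * pd2 Ψ 1 2 K - 1 / 2 * (K 1 * pd Ψ 1 K),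
      K 2 ^ 2 * pd2 Ψ 2 2 K]

theorem cof_mul_transpose (F : Mat3) : cof F * (cof F)ᵀ = F.det ^ 2 • ((F * Fᵀ)⁻¹)ᵀ := by
  rw [Matrix.mul_inv_rev, Matrix.transpose_mul, ← Matrix.transpose_nonsing_inv,
    Matrix.transpose_transpose]
  simp [cof, smul_smul, sq]

/-- `W(F) = Ŵ(log V)` for `F ∈ GL⁺(3)` with `V = exp X` the left stretch tensor of `F`,
that is `V² = F Fᵀ`. -/
theorem energy_eq_henckyEnergy (Ψ : (Fin 3 → ℝ) → ℝ) {F : Mat3} (hF : 0 < F.det) (X : Sym3)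
    (h : stretch X * stretch X = F * Fᵀ) : energy Ψ F = henckyEnergy Ψ X := by
  have hs : (stretch X)ᵀ = stretch X := by
    unfold stretch
    rw [← Matrix.exp_transpose, X.transpose_toMat]
  have h' : F * Fᵀ = stretch X * (stretch X)ᵀ := by rw [hs, h]
  have hV : 0 < (stretch X).det := by
    have h2 : stretch X = NormedSpace.exp ((1 / 2 : ℝ) • X.toMat) *
        NormedSpace.exp ((1 / 2 : ℝ) • X.toMat) := by
      rw [← Matrix.exp_add_of_commute _ _ (Commute.refl _), ← add_smul]
      norm_num [stretch]
    have hu := (Matrix.isUnit_iff_isUnit_det _).1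
      (Matrix.isUnit_exp ((1 / 2 : ℝ) • X.toMat))
    rw [h2, Matrix.det_mul]
    exact mul_self_pos.2 hu.ne_zero
  have hd : F.det = (stretch X).det := by
    have h2 := congrArg Matrix.det h'
    rw [Matrix.det_mul, Matrix.det_mul, Matrix.det_transpose, Matrix.det_transpose] at h2
    nlinarith
  unfold henckyEnergy energy rootInv frob
  rw [cof_mul_transpose, cof_mul_transpose, h', hd]

end Elast

end

/-!
In the Hencky strain `X = log V` the logarithms of the root invariants are
`log K₁ = ½ log tr exp (2X)`, `log K₂ = tr X + ½ log tr exp (-2X)` and `log K₃ = tr X`. Let `a` be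
the vector of their first derivatives at `X` in the direction `H`, and `b₁, b₂` the second
derivatives of the first two. Since `⟨σ̂, H⟩ = e^{-tr X} DŴ(X)[H]`, the chain rule gives
`⟨Dσ̂[H], H⟩ = J⁻¹ (⟨a, M a⟩ + K₁ Ψ₁ b₁ + K₂ Ψ₂ b₂)`: the factor `e^{-tr X}` contributes
`-a₃ Σ KᵢΨᵢaᵢ`, which produces the terms `-½ KᵢΨᵢ` of `M` and cancels `K₃Ψ₃a₃²`
(`inner_fderiv_cauchyStress`).

The numbers `b₁, b₂` are nonnegative, and positive unless `H` is a multiple of the identity,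
because `log tr exp` is convex (`Matrix.exists_hasDerivAt_deriv_logTraceExp`). This is the strict
Cauchy–Schwarz inequality for the form `(H, K) ↦ tr (D exp(A)[H] K)` applied to `H` and `1`; the
form is positive definite by the Daleckii–Krein formula (`Matrix.fderiv_exp_diagonal`), as the
divided differences of the exponential function are positive. When `H = m • 1` with `m ≠ 0`,
one has `a = m (1, 2, 3)`, and `⟨a, M a⟩ > 0` by the condition on `(1, 2, 3)`.
-/

/-! ### Lines in a normed space -/

theorem hasDerivAt_const_add_smul {E : Type*} [NormedAddCommGroup E] [NormedSpace ℝ E] (A H : E)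
    (t : ℝ) : HasDerivAt (fun t : ℝ => A + t • H) H t := by
  simpa using ((hasDerivAt_id t).smul_const H).const_add A

noncomputable section MatrixExponential

open scoped Matrix.Norms.Operator
open NormedSpace (exp)

variable {n : Type*} [Fintype n] [DecidableEq n]

/-! ### Derivative of the matrix exponential -/

theorem Matrix.contDiff_exp {k : WithTop ℕ∞} : ContDiff ℝ k (exp : Matrix n n ℝ → Matrix n n ℝ) :=
  (AnalyticOnNhd.contDiff fun x _ => NormedSpace.exp_analytic x : ContDiff ℝ k _)

theorem Matrix.differentiable_exp : Differentiable ℝ (exp : Matrix n n ℝ → Matrix n n ℝ) :=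
  (Matrix.contDiff_exp (k := 1)).differentiable one_ne_zero

theorem Matrix.fderiv_exp_eq_of_hasDerivAt {A H E : Matrix n n ℝ}
    (h : HasDerivAt (fun t : ℝ => exp (A + t • H)) E 0) : fderiv ℝ exp A H = E := by
  have h1 : HasDerivAt (fun t : ℝ => A + t • H) H 0 := hasDerivAt_const_add_smul A H 0
  have h2 : HasFDerivAt exp (fderiv ℝ exp A) (A + (0 : ℝ) • H) := by
    simpa using (Matrix.differentiable_exp A).hasFDerivAt
  exact (h2.comp_hasDerivAt 0 h1).unique h

theorem Matrix.fderiv_exp_of_commute {A H : Matrix n n ℝ} (h : Commute A H) :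
    fderiv ℝ exp A H = exp A * H := by
  apply Matrix.fderiv_exp_eq_of_hasDerivAt
  have h1 : (fun t : ℝ => exp (A + t • H)) = fun t : ℝ => exp A * exp (t • H) := by
    funext t
    exact Matrix.exp_add_of_commute _ _ (h.smul_right t)
  rw [h1]
  have h2 := (hasDerivAt_exp_smul_const (𝕂 := ℝ) H (0 : ℝ)).const_mul (exp A)
  rw [zero_smul, NormedSpace.exp_zero, one_mul] at h2
  exact h2

theorem Matrix.fderiv_exp_conj (U : (Matrix n n ℝ)ˣ) (A H : Matrix n n ℝ) :
    fderiv ℝ exp (U * A * U⁻¹) (U * H * U⁻¹) = U * fderiv ℝ exp A H * U⁻¹ := by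
  apply Matrix.fderiv_exp_eq_of_hasDerivAt
  have h1 : (fun t : ℝ => exp (U * A * U⁻¹ + t • (U * H * U⁻¹))) =
      fun t : ℝ => (U : Matrix n n ℝ) * exp (A + t • H) * (U⁻¹ : (Matrix n n ℝ)ˣ) := by
    funext t
    rw [← Matrix.exp_units_conj]
    simp [mul_add, add_mul]
  have h0 : HasDerivAt (fun t : ℝ => A + t • H) H 0 := hasDerivAt_const_add_smul A H 0
  have h2 : HasFDerivAt exp (fderiv ℝ exp A) (A + (0 : ℝ) • H) := by
    simpa using (Matrix.differentiable_exp A).hasFDerivAt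
  rw [h1]
  exact ((h2.comp_hasDerivAt 0 h0).const_mul _).mul_const _

theorem Matrix.exp_real_diagonal (d : n → ℝ) :
    exp (diagonal d) = diagonal fun i => Real.exp (d i) := by
  rw [Matrix.exp_diagonal, Real.exp_eq_exp_ℝ]
  congr 1
  funext i
  exact Pi.coe_exp d i

/-- For `d i ≠ d j` the matrix `diagonal d + t • single i j c` is the conjugate of `diagonal d` by a
matrix `1 + single i j s`, so its exponential is affine in `t`; for `d i = d j` the two summands
commute. -/
theorem Matrix.fderiv_exp_diagonal_single (d : n → ℝ) (i j : n) (c : ℝ) :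
    fderiv ℝ exp (diagonal d) (single i j c) =
      single i j (dslope Real.exp (d j) (d i) * c) := by
  rcases eq_or_ne (d i) (d j) with hij | hij
  · rw [Matrix.fderiv_exp_of_commute, Matrix.exp_real_diagonal, hij, dslope_same, Real.deriv_exp]
    · ext a b
      simp only [Matrix.diagonal_mul, Matrix.single_apply]
      split_ifs with h
      · rw [← h.1, hij]
      · simp
    · ext a b
      simp only [Matrix.diagonal_mul, Matrix.mul_diagonal, Matrix.single_apply]
      split_ifs with h
      · rw [← h.1, ← h.2, hij, mul_comm]
      · simp
  · have hne : i ≠ j := fun h => hij (by rw [h])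
    have hsq (a b : ℝ) : single i j a * single i j b = 0 := by simp [hne.symm]
    -- `1 + single i j s` is invertible and conjugates `diagonal d` to
    -- `diagonal d + single i j (s * (d j - d i))`
    have key (t : ℝ) : exp (diagonal d + t • single i j c) =
        exp (diagonal d) + t • single i j (dslope Real.exp (d j) (d i) * c) := by
      have hsub : d j - d i ≠ 0 := sub_ne_zero.2 hij.symm
      let s : ℝ := t * c / (d j - d i)
      let U : (Matrix n n ℝ)ˣ :=
        { val := 1 + single i j s
          inv := 1 - single i j s
          val_inv := by simp [mul_sub, add_mul, hsq]
          inv_val := by simp [mul_add, sub_mul, hsq] }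
      have hconj (e : n → ℝ) : (U : Matrix n n ℝ) * diagonal e * (U⁻¹ : (Matrix n n ℝ)ˣ) =
          diagonal e + single i j (s * (e j - e i)) := by
        change (1 + single i j s) * diagonal e * (1 - single i j s) = _
        have h1 : single i j s * diagonal e = single i j (s * e j) := by
          ext a b
          simp only [Matrix.mul_diagonal, Matrix.single_apply]
          split_ifs with h
          · rw [h.2]
          · simp
        have h2 : diagonal e * single i j s = single i j (s * e i) := by
          ext a b
          simp only [Matrix.diagonal_mul, Matrix.single_apply]
          split_ifs with h
          · rw [h.1, mul_comm]
          · simp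
        rw [add_mul, mul_sub, mul_one, one_mul, add_mul, h1, h2, hsq, add_zero, mul_sub,
          sub_eq_add_neg (s * e j), Matrix.single_add]
        have h3 : single i j (-(s * e i)) = -single i j (s * e i) := by
          ext a b; simp only [Matrix.single_apply, Matrix.neg_apply]; split_ifs <;> simp
        rw [h3]; abel
      have h1 : diagonal d + t • single i j c =
          (U : Matrix n n ℝ) * diagonal d * (U⁻¹ : (Matrix n n ℝ)ˣ) := by
        rw [hconj, Matrix.smul_single, smul_eq_mul]
        congr 2
        simp only [s]; field_simp
      rw [h1, Matrix.exp_units_conj, Matrix.exp_real_diagonal, hconj, Matrix.smul_single,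
        smul_eq_mul, dslope_of_ne _ hij, slope_def_field]
      congr 2
      have hsub' : d i - d j ≠ 0 := sub_ne_zero.2 hij
      simp only [s]; field_simp; ring
    apply Matrix.fderiv_exp_eq_of_hasDerivAt
    simp_rw [key]
    exact hasDerivAt_const_add_smul _ _ 0

/-- The Daleckii–Krein formula: at a diagonal matrix the derivative of `exp` is Schur multiplication
by the divided differences of `Real.exp` at the diagonal entries. -/
theorem Matrix.fderiv_exp_diagonal (d : n → ℝ) (H : Matrix n n ℝ) :
    fderiv ℝ exp (diagonal d) H =
      of fun i j => dslope Real.exp (d j) (d i) * H i j := by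
  conv_lhs => rw [Matrix.matrix_eq_sum_single H]
  simp only [map_sum, Matrix.fderiv_exp_diagonal_single]
  conv_rhs => rw [Matrix.matrix_eq_sum_single (of _)]
  rfl

theorem Real.dslope_exp_pos (a b : ℝ) : 0 < dslope Real.exp a b := by
  rcases eq_or_ne b a with rfl | h
  · rw [dslope_same, Real.deriv_exp]; positivity
  · rw [dslope_of_ne _ h]
    exact (Real.exp_strictMono.strictMonoOn Set.univ).slope_pos (Set.mem_univ _)
      (Set.mem_univ _) h.symm

/-- The spectral theorem for real symmetric matrices, with the orthogonal matrix packaged as a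
unit. -/
theorem Matrix.IsHermitian.exists_units_conj_diagonal {A : Matrix n n ℝ} (hA : A.IsHermitian) :
    ∃ (U : (Matrix n n ℝ)ˣ) (d : n → ℝ), (U⁻¹ : (Matrix n n ℝ)ˣ) = (U : Matrix n n ℝ)ᵀ ∧
      A = U * diagonal d * (U⁻¹ : (Matrix n n ℝ)ˣ) := by
  refine ⟨Unitary.toUnits hA.eigenvectorUnitary, hA.eigenvalues, ?_, ?_⟩
  · simp [Matrix.star_eq_conjTranspose]
  · conv_lhs => rw [hA.spectral_theorem]
    simp [Unitary.conjStarAlgAut_apply]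

/-! ### Trace inequalities -/

theorem Matrix.trace_fderiv_exp {A : Matrix n n ℝ} (hA : A.IsHermitian) (H : Matrix n n ℝ) :
    (fderiv ℝ exp A H).trace = (exp A * H).trace := by
  obtain ⟨U, d, -, rfl⟩ := hA.exists_units_conj_diagonal
  obtain ⟨K, rfl⟩ : ∃ K, H = U * K * (U⁻¹ : (Matrix n n ℝ)ˣ) :=
    ⟨(U⁻¹ : (Matrix n n ℝ)ˣ) * H * U, by simp [mul_assoc]⟩
  have h1 (B : Matrix n n ℝ) : (U * B * (U⁻¹ : (Matrix n n ℝ)ˣ)).trace = B.trace := by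
    rw [Matrix.trace_mul_comm, ← mul_assoc, Units.inv_mul, one_mul]
  have h2 : U * exp (diagonal d) * (U⁻¹ : (Matrix n n ℝ)ˣ) * (U * K * (U⁻¹ : (Matrix n n ℝ)ˣ)) =
      U * (exp (diagonal d) * K) * (U⁻¹ : (Matrix n n ℝ)ˣ) := by
    simp [mul_assoc]
  rw [Matrix.fderiv_exp_conj, Matrix.exp_units_conj, h2, h1, h1, Matrix.fderiv_exp_diagonal,
    Matrix.exp_real_diagonal]
  simp [Matrix.trace, Matrix.diagonal_mul, dslope_same]

/-- The bilinear form `(H, K) ↦ tr (D exp(A)[H] K)` is positive definite on symmetric matrices: in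
an eigenbasis of `A` its quadratic form is a sum of squares weighted by the divided differences of
`Real.exp`. -/
theorem Matrix.trace_fderiv_exp_mul_pos {A H : Matrix n n ℝ} (hA : A.IsHermitian)
    (hH : H.IsSymm) (h0 : H ≠ 0) : 0 < (fderiv ℝ exp A H * H).trace := by
  obtain ⟨U, d, hU, rfl⟩ := hA.exists_units_conj_diagonal
  obtain ⟨K, hK, rfl⟩ : ∃ K : Matrix n n ℝ, K.IsSymm ∧ H = U * K * (U⁻¹ : (Matrix n n ℝ)ˣ) := by
    refine ⟨(U⁻¹ : (Matrix n n ℝ)ˣ) * H * U, ?_, by simp [mul_assoc]⟩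
    rw [Matrix.IsSymm, hU]
    simp [Matrix.transpose_mul, hH.eq, mul_assoc]
  have h1 (B : Matrix n n ℝ) : (U * B * (U⁻¹ : (Matrix n n ℝ)ˣ)).trace = B.trace := by
    rw [Matrix.trace_mul_comm, ← mul_assoc, Units.inv_mul, one_mul]
  have h2 (B : Matrix n n ℝ) :
      U * B * (U⁻¹ : (Matrix n n ℝ)ˣ) * (U * K * (U⁻¹ : (Matrix n n ℝ)ˣ)) =
      U * (B * K) * (U⁻¹ : (Matrix n n ℝ)ˣ) := by
    simp [mul_assoc]
  rw [Matrix.fderiv_exp_conj, h2, h1, Matrix.fderiv_exp_diagonal]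
  have h3 : ((of fun i j => dslope Real.exp (d j) (d i) * K i j) * K).trace =
      ∑ i, ∑ j, dslope Real.exp (d j) (d i) * K i j ^ 2 := by
    simp only [Matrix.trace, Matrix.diag, Matrix.mul_apply, Matrix.of_apply]
    refine Finset.sum_congr rfl fun i _ => Finset.sum_congr rfl fun j _ => ?_
    rw [hK.apply]; ring
  have h4 (i j : n) : 0 ≤ dslope Real.exp (d j) (d i) * K i j ^ 2 :=
    mul_nonneg (Real.dslope_exp_pos _ _).le (sq_nonneg _)
  obtain ⟨i, j, hij⟩ : ∃ i j, K i j ≠ 0 := by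
    by_contra! hc
    exact h0 (by rw [show K = 0 from Matrix.ext hc]; simp)
  rw [h3]
  refine Finset.sum_pos' (fun i _ => Finset.sum_nonneg fun j _ => h4 i j) ⟨i, Finset.mem_univ _, ?_⟩
  refine Finset.sum_pos' (fun j _ => h4 i j) ⟨j, Finset.mem_univ _, ?_⟩
  have := Real.dslope_exp_pos (d j) (d i)
  positivity

theorem Matrix.trace_exp_pos [Nonempty n] {A : Matrix n n ℝ} (hA : A.IsHermitian) :
    0 < (exp A).trace := by
  obtain ⟨U, d, -, rfl⟩ := hA.exists_units_conj_diagonal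
  rw [Matrix.exp_units_conj, Matrix.trace_mul_comm, ← mul_assoc, Units.inv_mul, one_mul,
    Matrix.exp_real_diagonal, Matrix.trace_diagonal]
  exact Finset.sum_pos (fun i _ => Real.exp_pos _) Finset.univ_nonempty

theorem Matrix.det_exp_of_isHermitian {A : Matrix n n ℝ} (hA : A.IsHermitian) :
    (exp A).det = Real.exp A.trace := by
  obtain ⟨U, d, -, rfl⟩ := hA.exists_units_conj_diagonal
  rw [Matrix.exp_units_conj, Matrix.det_units_conj, Matrix.trace_mul_comm, ← mul_assoc,
    Units.inv_mul, one_mul, Matrix.exp_real_diagonal, Matrix.det_diagonal, Matrix.trace_diagonal,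
    Real.exp_sum]

theorem Matrix.trace_fderiv_exp_sub_smul_one {A : Matrix n n ℝ} (hA : A.IsHermitian)
    (H : Matrix n n ℝ) (m : ℝ) :
    (fderiv ℝ exp A (H - m • 1) * (H - m • 1)).trace =
      (fderiv ℝ exp A H * H).trace - 2 * m * (exp A * H).trace + m ^ 2 * (exp A).trace := by
  rw [map_sub, map_smul, Matrix.fderiv_exp_of_commute (Commute.one_right A), mul_one]
  simp only [sub_mul, mul_sub, Matrix.trace_sub, smul_mul_assoc, mul_smul_comm, mul_one,
    Matrix.trace_smul, smul_eq_mul, Matrix.trace_fderiv_exp hA]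
  ring

/-- Strict Cauchy–Schwarz inequality for the positive definite form `(H, K) ↦ tr (D exp(A)[H] K)`
and the vectors `H` and `1`. -/
theorem Matrix.sq_trace_exp_mul_lt [Nonempty n] {A H : Matrix n n ℝ} (hA : A.IsHermitian)
    (hH : H.IsSymm) (hs : ∀ m : ℝ, H ≠ m • 1) :
    (exp A * H).trace ^ 2 < (exp A).trace * (fderiv ℝ exp A H * H).trace := by
  have hT := Matrix.trace_exp_pos hA
  -- the multiple of `1` subtracted from `H` is its orthogonal projection onto `ℝ • 1` for the form
  have h := Matrix.trace_fderiv_exp_mul_pos (H := H - ((exp A * H).trace / (exp A).trace) • 1) hA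
    (hH.sub ((Matrix.isSymm_one).smul _)) (sub_ne_zero.2 (hs _))
  rw [Matrix.trace_fderiv_exp_sub_smul_one hA] at h
  have h2 := mul_pos hT h
  have h3 : (exp A).trace * ((fderiv ℝ exp A H * H).trace -
      2 * ((exp A * H).trace / (exp A).trace) * (exp A * H).trace +
      ((exp A * H).trace / (exp A).trace) ^ 2 * (exp A).trace) =
      (exp A).trace * (fderiv ℝ exp A H * H).trace - (exp A * H).trace ^ 2 := by
    field_simp
    ring
  linarith

/-! ### Convexity of the logarithm of the trace exponential -/

/-- The function `A ↦ log (tr (exp A))`, convex on the symmetric matrices. -/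
def Matrix.logTraceExp (A : Matrix n n ℝ) : ℝ := Real.log (exp A).trace

theorem Matrix.hasDerivAt_exp_add_smul (A B : Matrix n n ℝ) (t : ℝ) :
    HasDerivAt (fun t : ℝ => exp (A + t • B)) (fderiv ℝ exp (A + t • B) B) t :=
  (Matrix.differentiable_exp _).hasFDerivAt.comp_hasDerivAt t (hasDerivAt_const_add_smul A B t)

theorem Matrix.hasDerivAt_trace_exp_add_smul_mul (A B C : Matrix n n ℝ) (t : ℝ) :
    HasDerivAt (fun t : ℝ => (exp (A + t • B) * C).trace)
      (fderiv ℝ exp (A + t • B) B * C).trace t :=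
  (Matrix.traceLinearMap n ℝ ℝ).toContinuousLinearMap.hasFDerivAt.comp_hasDerivAt t
    ((Matrix.hasDerivAt_exp_add_smul A B t).mul_const C)

theorem Matrix.hasDerivAt_logTraceExp [Nonempty n] {A B : Matrix n n ℝ} (hA : A.IsHermitian)
    (hB : B.IsHermitian) (t : ℝ) :
    HasDerivAt (fun t : ℝ => logTraceExp (A + t • B))
      ((exp (A + t • B) * B).trace / (exp (A + t • B)).trace) t := by
  have hH : (A + t • B).IsHermitian := hA.add (hB.smul (IsSelfAdjoint.all t))
  have h := Matrix.hasDerivAt_trace_exp_add_smul_mul A B 1 t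
  simp only [mul_one, Matrix.trace_fderiv_exp hH] at h
  exact h.log (Matrix.trace_exp_pos hH).ne'

/-- The second derivative of `logTraceExp` at a symmetric `A` in a symmetric direction `B` exists,
is nonnegative, and is positive unless `B` is a multiple of the identity. -/
theorem Matrix.exists_hasDerivAt_deriv_logTraceExp [Nonempty n] {A B : Matrix n n ℝ}
    (hA : A.IsHermitian) (hB : B.IsHermitian) :
    ∃ b : ℝ, HasDerivAt
        (fun t : ℝ => (exp (A + t • B) * B).trace / (exp (A + t • B)).trace) b 0 ∧
      0 ≤ b ∧ ((∀ m : ℝ, B ≠ m • 1) → 0 < b) := by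
  have hT := Matrix.trace_exp_pos hA
  have h1 := Matrix.hasDerivAt_trace_exp_add_smul_mul A B B 0
  have h2 := Matrix.hasDerivAt_trace_exp_add_smul_mul A B 1 0
  simp only [mul_one, zero_smul, add_zero, Matrix.trace_fderiv_exp hA] at h1 h2
  have h3 := h1.fun_div h2 (by simpa using hT.ne')
  simp only [zero_smul, add_zero] at h3
  refine ⟨_, h3, ?_⟩
  have hpos (hs : ∀ m : ℝ, B ≠ m • 1) := Matrix.sq_trace_exp_mul_lt hA
    (by simpa [Matrix.IsHermitian, Matrix.IsSymm,
      Matrix.conjTranspose_eq_transpose_of_trivial] using hB) hs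
  refine ⟨?_, fun hs => div_pos (by linarith [hpos hs]) (by positivity)⟩
  by_cases hs : ∀ m : ℝ, B ≠ m • 1
  · exact div_nonneg (by linarith [hpos hs]) (by positivity)
  · push Not at hs
    obtain ⟨m, rfl⟩ := hs
    rw [map_smul, Matrix.fderiv_exp_of_commute (Commute.one_right A)]
    simp only [mul_one, mul_smul_comm, Matrix.trace_smul, smul_eq_mul]
    exact div_nonneg (le_of_eq (by ring)) (by positivity)

theorem Matrix.contDiffAt_logTraceExp [Nonempty n] {k : WithTop ℕ∞} {A : Matrix n n ℝ}
    (hA : A.IsHermitian) : ContDiffAt ℝ k logTraceExp A :=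
  ((Matrix.traceLinearMap n ℝ ℝ).toContinuousLinearMap.contDiff.comp
    Matrix.contDiff_exp).contDiffAt.log (Matrix.trace_exp_pos hA).ne'

end MatrixExponential

noncomputable section

namespace Elast

/-! ### Root invariants in terms of the Hencky strain -/

theorem Sym3.isHermitian_toMat (X : Sym3) : X.toMat.IsHermitian := by
  rw [Matrix.IsHermitian, Matrix.conjTranspose_eq_transpose_of_trivial, X.transpose_toMat]

theorem Sym3.isHermitian_smul_toMat (c : ℝ) (X : Sym3) : (c • X.toMat).IsHermitian :=
  X.isHermitian_toMat.smul (IsSelfAdjoint.all c)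

theorem det_stretch (X : Sym3) : (stretch X).det = Real.exp X.toMat.trace :=
  Matrix.det_exp_of_isHermitian X.isHermitian_toMat

theorem det_stretch_pos (X : Sym3) : 0 < (stretch X).det := by
  rw [det_stretch]; exact Real.exp_pos _

theorem frob_exp (c : ℝ) (X : Sym3) :
    frob (NormedSpace.exp (c • X.toMat)) =
      Real.exp (1 / 2 * logTraceExp ((2 * c) • X.toMat)) := by
  have h : NormedSpace.exp (c • X.toMat) * (NormedSpace.exp (c • X.toMat))ᵀ =
      NormedSpace.exp ((2 * c) • X.toMat) := by
    rw [← Matrix.exp_transpose, Matrix.transpose_smul, X.transpose_toMat,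
      ← Matrix.exp_add_of_commute _ _ (Commute.refl _), ← add_smul, two_mul]
  have hT := Matrix.trace_exp_pos (X.isHermitian_smul_toMat (2 * c))
  rw [frob, h, logTraceExp, Real.sqrt_eq_rpow, Real.rpow_def_of_pos hT, mul_comm]

theorem frob_smul {r : ℝ} (hr : 0 ≤ r) (A : Mat3) : frob (r • A) = r * frob A := by
  rw [frob, frob, Matrix.transpose_smul, smul_mul_smul_comm, Matrix.trace_smul, smul_eq_mul,
    Real.sqrt_mul (by positivity), Real.sqrt_mul_self hr]

/-- The logarithms of the root invariants of `exp X`, in closed form: `log K₁` and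
`log K₂ - log K₃` are half of `logTraceExp` at `2X` and `-2X`, and `log K₃ = tr X`. -/
def logRootInv (X : Sym3) : Fin 3 → ℝ :=
  ![1 / 2 * logTraceExp ((2 : ℝ) • X.toMat),
    X.toMat.trace + 1 / 2 * logTraceExp ((-2 : ℝ) • X.toMat),
    X.toMat.trace]

theorem rootInv_stretch (X : Sym3) : rootInv (stretch X) = fun i => Real.exp (logRootInv X i) := by
  have h0 := frob_exp 1 X
  have h1 := frob_exp (-1) X
  have hc : cof (stretch X) = Real.exp X.toMat.trace • NormedSpace.exp ((-1 : ℝ) • X.toMat) := by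
    rw [cof, det_stretch, stretch, ← Matrix.exp_neg, ← Matrix.exp_transpose, Matrix.transpose_neg,
      X.transpose_toMat, neg_one_smul]
  norm_num at h0 h1
  funext i
  fin_cases i
  · simpa [rootInv, logRootInv, stretch] using h0
  · simp [rootInv, logRootInv, hc, frob_smul (Real.exp_pos _).le, h1, Real.exp_add]
  · simp [rootInv, logRootInv, det_stretch]

open scoped Matrix.Norms.Operator in
theorem contDiff_logRootInv {k : WithTop ℕ∞} : ContDiff ℝ k logRootInv := by
  have h (c : ℝ) : ContDiff ℝ k fun X : Sym3 => logTraceExp (c • X.toMat) := by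
    refine contDiff_iff_contDiffAt.2 fun X => ?_
    exact ContDiffAt.comp (g := logTraceExp) (f := fun X : Sym3 => c • X.toMat) X
      (contDiffAt_logTraceExp (X.isHermitian_smul_toMat c))
      ((c • Sym3.toMat).toContinuousLinearMap.contDiff.contDiffAt)
  have ht : ContDiff ℝ k fun X : Sym3 => X.toMat.trace :=
    ((Matrix.traceLinearMap (Fin 3) ℝ ℝ) ∘ₗ Sym3.toMat).toContinuousLinearMap.contDiff
  rw [contDiff_pi]
  intro i
  fin_cases i
  · exact contDiff_const.mul (h 2)
  · exact ht.add (contDiff_const.mul (h (-2)))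
  · exact ht

theorem contDiff_rootInv_stretch {k : WithTop ℕ∞} :
    ContDiff ℝ k fun X : Sym3 => rootInv (stretch X) := by
  simp_rw [rootInv_stretch]
  exact contDiff_pi.2 fun i => ((contDiff_pi.1 contDiff_logRootInv) i).exp

/-- The derivative of `t ↦ logRootInv (X + t • H)` at `t`. -/
def logRootInvDeriv (X H : Sym3) (t : ℝ) : Fin 3 → ℝ :=
  let r (c : ℝ) : ℝ :=
    (NormedSpace.exp (c • X.toMat + t • c • H.toMat) * (c • H.toMat)).trace /
      (NormedSpace.exp (c • X.toMat + t • c • H.toMat)).trace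
  ![1 / 2 * r 2, H.toMat.trace + 1 / 2 * r (-2), H.toMat.trace]

theorem hasDerivAt_logRootInv (X H : Sym3) (t : ℝ) (i : Fin 3) :
    HasDerivAt (fun t : ℝ => logRootInv (X + t • H) i) (logRootInvDeriv X H t i) t := by
  have hr (c : ℝ) : HasDerivAt (fun t : ℝ => logTraceExp (c • (X + t • H).toMat))
      ((NormedSpace.exp (c • X.toMat + t • c • H.toMat) * (c • H.toMat)).trace /
        (NormedSpace.exp (c • X.toMat + t • c • H.toMat)).trace) t := by
    have := hasDerivAt_logTraceExp (X.isHermitian_smul_toMat c) (H.isHermitian_smul_toMat c) t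
    simpa only [map_add, map_smul, smul_add, smul_comm c] using this
  have ht : HasDerivAt (fun t : ℝ => (X + t • H).toMat.trace) H.toMat.trace t := by
    simpa using hasDerivAt_const_add_smul X.toMat.trace H.toMat.trace t
  fin_cases i
  · exact (hr 2).const_mul _
  · exact ht.add ((hr (-2)).const_mul _)
  · exact ht

/-- `log K₁` and `log K₂` are convex functions of the Hencky strain, strictly convex in every
direction that is not a multiple of the identity. -/
theorem exists_hasDerivAt_logRootInvDeriv (X H : Sym3) :
    ∃ b : Fin 3 → ℝ, (∀ i, HasDerivAt (fun t => logRootInvDeriv X H t i) (b i) 0) ∧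
      b 2 = 0 ∧ 0 ≤ b 0 ∧ 0 ≤ b 1 ∧ ((∀ m : ℝ, H.toMat ≠ m • 1) → 0 < b 0 ∧ 0 < b 1) := by
  have h (c : ℝ) := exists_hasDerivAt_deriv_logTraceExp (X.isHermitian_smul_toMat c)
    (H.isHermitian_smul_toMat c)
  have hs (c : ℝ) (hc : c ≠ 0) (hH : ∀ m : ℝ, H.toMat ≠ m • 1) (m : ℝ) : c • H.toMat ≠ m • 1 := by
    intro h
    apply hH (c⁻¹ * m)
    rw [mul_smul, ← h, smul_smul, inv_mul_cancel₀ hc, one_smul]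
  obtain ⟨b, hb, hb0, hbp⟩ := h 2
  obtain ⟨b', hb', hb0', hbp'⟩ := h (-2)
  refine ⟨![1 / 2 * b, 1 / 2 * b', 0], fun i => ?_, rfl, by simpa using hb0, by simpa using hb0',
    fun hH => ⟨by simpa using hbp (hs 2 (by norm_num) hH),
      by simpa using hbp' (hs (-2) (by norm_num) hH)⟩⟩
  fin_cases i
  · exact hb.const_mul _
  · exact (hb'.const_mul _).const_add _
  · exact hasDerivAt_const _ _

/-- `‖V‖`, `‖cof V‖` and `det V` are homogeneous in `V` of degrees `1`, `2` and `3`. -/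
theorem logRootInvDeriv_of_toMat_eq_smul_one (X : Sym3) {H : Sym3} {m : ℝ} (hH : H.toMat = m • 1) :
    logRootInvDeriv X H 0 = m • ![1, 2, 3] := by
  have hT (c : ℝ) := (trace_exp_pos (X.isHermitian_smul_toMat c)).ne'
  have h2 := hT 2
  have h2' := hT (-2)
  funext i
  fin_cases i
  · simp [logRootInvDeriv, hH]
    field_simp
  · simp [logRootInvDeriv, hH] at h2' ⊢
    field_simp
    ring
  · simp [logRootInvDeriv, hH]

/-! ### Partial derivatives of the strain energy -/

theorem fderiv_eq_sum_pd (Ψ : (Fin 3 → ℝ) → ℝ) (K v : Fin 3 → ℝ) :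
    fderiv ℝ Ψ K v = ∑ i, v i * pd Ψ i K := by
  conv_lhs => rw [pi_eq_sum_univ' v]
  simp [pd, map_sum]

theorem differentiableAt_pd {Ψ : (Fin 3 → ℝ) → ℝ} {K : Fin 3 → ℝ} (h : ContDiffAt ℝ 2 Ψ K)
    (i : Fin 3) : DifferentiableAt ℝ (pd Ψ i) K :=
  ((h.fderiv_right (m := 1) (by norm_num)).differentiableAt one_ne_zero).clm_apply
    (differentiableAt_const _)

theorem pd2_comm {Ψ : (Fin 3 → ℝ) → ℝ} {K : Fin 3 → ℝ} (h : ContDiffAt ℝ 2 Ψ K)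
    (i j : Fin 3) : pd2 Ψ i j K = pd2 Ψ j i K := by
  have hd : DifferentiableAt ℝ (fderiv ℝ Ψ) K :=
    (h.fderiv_right (m := 1) (by norm_num)).differentiableAt one_ne_zero
  have key (i j : Fin 3) :
      pd2 Ψ i j K = fderiv ℝ (fderiv ℝ Ψ) K (Pi.single i 1) (Pi.single j 1) := by
    have : HasFDerivAt (pd Ψ j) _ K := hd.hasFDerivAt.clm_apply (hasFDerivAt_const _ _)
    rw [pd2, pd, this.fderiv]
    simp
  rw [key, key, (h.isSymmSndFDerivAt (by simp)).eq]

/-! ### Derivative of the Cauchy stress -/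

theorem contDiffAt_henckyEnergy {Ψ : (Fin 3 → ℝ) → ℝ} {X : Sym3}
    (h : ContDiffAt ℝ 2 Ψ (rootInv (stretch X))) : ContDiffAt ℝ 2 (henckyEnergy Ψ) X :=
  ContDiffAt.comp (g := Ψ) (f := fun X => rootInv (stretch X)) X h
    contDiff_rootInv_stretch.contDiffAt

theorem differentiableAt_cauchyStress {Ψ : (Fin 3 → ℝ) → ℝ} {X : Sym3}
    (h : ContDiffAt ℝ 2 Ψ (rootInv (stretch X))) : DifferentiableAt ℝ (cauchyStress Ψ) X := by
  have h1 : DifferentiableAt ℝ (fderiv ℝ (henckyEnergy Ψ)) X :=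
    ((contDiffAt_henckyEnergy h).fderiv_right (m := 1) (by norm_num)).differentiableAt one_ne_zero
  have h2 : DifferentiableAt ℝ (∇ (henckyEnergy Ψ)) X :=
    (InnerProductSpace.toDual ℝ Sym3).symm.toContinuousLinearEquiv.differentiableAt.comp X h1
  have h3 : DifferentiableAt ℝ (fun X : Sym3 => ((stretch X).det)⁻¹) X := by
    have : Differentiable ℝ fun X : Sym3 => rootInv (stretch X) 2 :=
      differentiable_pi.1 ((contDiff_rootInv_stretch (k := 1)).differentiable one_ne_zero) 2
    exact (this X).inv (det_stretch_pos X).ne'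
  exact h3.smul h2

theorem hasDerivAt_rootInv (X H : Sym3) (t : ℝ) (i : Fin 3) :
    HasDerivAt (fun t : ℝ => rootInv (stretch (X + t • H)) i)
      (rootInv (stretch (X + t • H)) i * logRootInvDeriv X H t i) t := by
  simp only [rootInv_stretch]
  exact (hasDerivAt_logRootInv X H t i).exp

theorem inner_cauchyStress {Ψ : (Fin 3 → ℝ) → ℝ} (X H : Sym3) (t : ℝ)
    (h : DifferentiableAt ℝ Ψ (rootInv (stretch (X + t • H)))) :
    ⟪cauchyStress Ψ (X + t • H), H⟫_ℝ = ((stretch (X + t • H)).det)⁻¹ *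
      ∑ i, rootInv (stretch (X + t • H)) i * logRootInvDeriv X H t i *
        pd Ψ i (rootInv (stretch (X + t • H))) := by
  have hd : DifferentiableAt ℝ (henckyEnergy Ψ) (X + t • H) :=
    DifferentiableAt.comp (g := Ψ) (f := fun X => rootInv (stretch X)) (X + t • H) h
      ((contDiff_rootInv_stretch (k := 1)).differentiable one_ne_zero _)
  have h1 := hd.hasFDerivAt.comp_hasDerivAt t (hasDerivAt_const_add_smul X H t)
  have h2 := h.hasFDerivAt.comp_hasDerivAt t (hasDerivAt_pi.2 (hasDerivAt_rootInv X H t))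
  rw [cauchyStress, real_inner_smul_left, inner_gradient_left, h1.unique h2, fderiv_eq_sum_pd]

/-- Second-order chain rule in the logarithms of the root invariants. The derivative of the
prefactor `J⁻¹` contributes `-tr H · J⁻¹ DŴ(X)[H]`; it yields the terms `-½ KᵢΨᵢ` in the third row
and column of `condMatrix` and removes `K₃Ψ₃` from the last diagonal entry. The vector `b` holds the
second derivatives of the logarithms along the line; the third vanishes as `log K₃` is linear. -/
theorem inner_fderiv_cauchyStress {Ψ : (Fin 3 → ℝ) → ℝ} {X : Sym3}
    (h : ContDiffAt ℝ 2 Ψ (rootInv (stretch X))) (H : Sym3) {b : Fin 3 → ℝ}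
    (hb : ∀ i, HasDerivAt (fun t => logRootInvDeriv X H t i) (b i) 0) (hb2 : b 2 = 0) :
    ⟪fderiv ℝ (cauchyStress Ψ) X H, H⟫_ℝ = ((stretch X).det)⁻¹ *
      (logRootInvDeriv X H 0 ⬝ᵥ (condMatrix Ψ (rootInv (stretch X)) *ᵥ logRootInvDeriv X H 0) +
        rootInv (stretch X) 0 * pd Ψ 0 (rootInv (stretch X)) * b 0 +
        rootInv (stretch X) 1 * pd Ψ 1 (rootInv (stretch X)) * b 1) := by
  have hX : X + (0 : ℝ) • H = X := by simp
  have hσ : HasDerivAt (fun t : ℝ => ⟪cauchyStress Ψ (X + t • H), H⟫_ℝ)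
      ⟪fderiv ℝ (cauchyStress Ψ) X H, H⟫_ℝ 0 := by
    have h1 : HasFDerivAt (cauchyStress Ψ) (fderiv ℝ (cauchyStress Ψ) X) (X + (0 : ℝ) • H) := by
      rw [hX]; exact (differentiableAt_cauchyStress h).hasFDerivAt
    simpa using (h1.comp_hasDerivAt 0 (hasDerivAt_const_add_smul X H 0)).inner ℝ
      (hasDerivAt_const 0 H)
  have hK := fun i => hasDerivAt_rootInv X H 0 i
  have hp (i : Fin 3) :
      HasDerivAt (fun t : ℝ => pd Ψ i (rootInv (stretch (X + t • H))))
        (∑ j, rootInv (stretch X) j * logRootInvDeriv X H 0 j * pd2 Ψ j i (rootInv (stretch X)))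
        0 := by
    have h1 : HasFDerivAt (pd Ψ i) (fderiv ℝ (pd Ψ i) (rootInv (stretch X)))
        (rootInv (stretch (X + (0 : ℝ) • H))) := by
      rw [hX]; exact (differentiableAt_pd h i).hasFDerivAt
    have h2 := h1.comp_hasDerivAt 0 (hasDerivAt_pi.2 hK)
    rw [fderiv_eq_sum_pd] at h2
    simpa only [hX] using! h2
  have hdet := (hK 2).fun_inv (by simpa [rootInv] using (det_stretch_pos _).ne')
  have hs := hdet.fun_mul (HasDerivAt.fun_sum fun i (_ : i ∈ Finset.univ) =>
    ((hK i).fun_mul (hb i)).fun_mul (hp i))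
  have hev : (fun t : ℝ => ⟪cauchyStress Ψ (X + t • H), H⟫_ℝ) =ᶠ[nhds 0] fun t =>
      (rootInv (stretch (X + t • H)) 2)⁻¹ * ∑ i, rootInv (stretch (X + t • H)) i *
        logRootInvDeriv X H t i * pd Ψ i (rootInv (stretch (X + t • H))) := by
    have hc : ContinuousAt (fun t : ℝ => rootInv (stretch (X + t • H))) 0 :=
      (hasDerivAt_pi.2 hK).continuousAt
    have h1 : ∀ᶠ K in nhds (rootInv (stretch (X + (0 : ℝ) • H))), ContDiffAt ℝ 2 Ψ K := by
      rw [hX]; exact h.eventually (by simp)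
    filter_upwards [hc.eventually h1] with t ht
    exact inner_cauchyStress X H t (ht.differentiableAt two_ne_zero)
  rw [hσ.unique (hs.congr_of_eventuallyEq hev)]
  simp only [hX, Fin.sum_univ_three, hb2, pd2_comm h 1 0, pd2_comm h 2 0, pd2_comm h 2 1]
  have hd : (stretch X).det = rootInv (stretch X) 2 := rfl
  have hd0 : rootInv (stretch X) 2 ≠ 0 := (det_stretch_pos X).ne'
  generalize hKdef : rootInv (stretch X) = K at *
  generalize logRootInvDeriv X H 0 = a
  rw [hd]
  simp only [condMatrix, Matrix.mulVec, dotProduct, Fin.sum_univ_three, Matrix.of_apply,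
    Matrix.cons_val]
  field_simp
  ring

end Elast
end

/-! ### Positive definiteness of the derivative of the Cauchy stress -/

open Elast in
/-- If `Ψ` is `C²` on the open set `U` and satisfies the stated conditions at the root invariants
of every `F ∈ GL⁺(3)` with `(K₁, K₂, K₃) ∈ U`, then the Cauchy stress satisfies TSTS-M⁺⁺ at every
Hencky strain whose root invariants lie in `U`. -/
theorem mainTheorem2 (U : Set (Fin 3 → ℝ)) (hU : IsOpen U) (Ψ : (Fin 3 → ℝ) → ℝ)
    (hΨ : ContDiffOn ℝ 2 Ψ U)
    (hmono : ∀ F : Mat3, 0 < F.det → rootInv F ∈ U →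
      (0 < pd Ψ 0 (rootInv F) ∧ 0 ≤ pd Ψ 1 (rootInv F)) ∨
        (0 ≤ pd Ψ 0 (rootInv F) ∧ 0 < pd Ψ 1 (rootInv F)))
    (hpsd : ∀ F : Mat3, 0 < F.det → rootInv F ∈ U → (condMatrix Ψ (rootInv F)).PosSemidef)
    (hadd : ∀ F : Mat3, 0 < F.det → rootInv F ∈ U →
      0 < ![1, 2, 3] ⬝ᵥ (condMatrix Ψ (rootInv F) *ᵥ ![1, 2, 3])) :
    TSTSMpp (cauchyStress Ψ) (admissible U) := by
  intro X hX H hH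
  have hX' : rootInv (stretch X) ∈ U := hX
  have hdet := det_stretch_pos X
  have hK : ∀ i, 0 < rootInv (stretch X) i := fun i => by
    rw [rootInv_stretch]; exact Real.exp_pos _
  obtain ⟨b, hb, hb2, hb0, hb1, hbpos⟩ := exists_hasDerivAt_logRootInvDeriv X H
  rw [inner_fderiv_cauchyStress (hΨ.contDiffAt (hU.mem_nhds hX')) H hb hb2]
  refine mul_pos (inv_pos.2 hdet) ?_
  have hm := hmono _ hdet hX'
  have hΨ0 : 0 ≤ pd Ψ 0 (rootInv (stretch X)) := hm.elim (fun h => h.1.le) fun h => h.1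
  have hΨ1 : 0 ≤ pd Ψ 1 (rootInv (stretch X)) := hm.elim (fun h => h.2) fun h => h.2.le
  have h0 := mul_nonneg (mul_nonneg (hK 0).le hΨ0) hb0
  have h1 := mul_nonneg (mul_nonneg (hK 1).le hΨ1) hb1
  by_cases hs : ∀ m : ℝ, H.toMat ≠ m • 1
  -- `H` is not spherical: `b 0` and `b 1` are positive, and so is `Ψ₁` or `Ψ₂`
  · have hM : 0 ≤ logRootInvDeriv X H 0 ⬝ᵥ
        (condMatrix Ψ (rootInv (stretch X)) *ᵥ logRootInvDeriv X H 0) :=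
      (hpsd _ hdet hX').dotProduct_mulVec_nonneg _
    obtain ⟨hb0', hb1'⟩ := hbpos hs
    rcases hm with hm | hm
    · have := mul_pos (mul_pos (hK 0) hm.1) hb0'
      linarith
    · have := mul_pos (mul_pos (hK 1) hm.2) hb1'
      linarith
  -- `H = m • 1`: the first derivatives of the logarithms are `m • (1, 2, 3)`
  · push Not at hs
    obtain ⟨m, hm1⟩ := hs
    have hm0 : m ≠ 0 := by
      rintro rfl
      exact hH (Sym3.toMat_injective (by rw [hm1, zero_smul, map_zero]))
    have hM := mul_pos (sq_pos_of_ne_zero hm0) (hadd _ hdet hX')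
    rw [logRootInvDeriv_of_toMat_eq_smul_one X hm1, Matrix.mulVec_smul, smul_dotProduct,
      dotProduct_smul, smul_eq_mul, smul_eq_mul, ← mul_assoc, ← sq]
    linarith
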